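/- Let $n,m$ be positive integers, let $\Omega\subseteq[n]\times[m]$ be a fixed set of observed positions, and let $\mathcal G(\Omega)$ be the bipartite graph with row vertices $u_1,\dots,u_n$ and column vertices $v_1,\dots,v_m$ in which $u_k$ and $v_\ell$ are adjacent if and only if $(k,\ell)\in\Omega$. Let $L$ be its graph Laplacian, $L^+$ the Moore–Penrose pseudo-inverse of $L$, and $B$ its oriented incidence matrix, in which the row of the edge $(u_k,v_\ell)$ is $(e_{u_k}-e_{v_\ell})^\top$. For vertices $s,t$ let $$R(s,t)=(e_s-e_t)^\top L^+(e_s-e_t)$$ be the effective resistance. One observes the data matrix $M=\Omega\circ(M^*+E)$, that is, $M_{k\ell}=M^*_{k\ell}+E_{k\ell}$ for $(k,\ell)\in\Omega$ and $M_{k\ell}=0$ otherwise. Here $M^*\in\mathbb R^{n\times m}$ is an unknown additive matrix ($M^*_{k\ell}=a_k+b_\ell$ for some $a\in\mathbb R^n$, $b\in\mathbb R^m$), and the entries of $E$ are i.i.d. $N(0,\sigma^2)$ with unknown $\sigma>0$. The electrical flow estimator of $M^*_{ij}$ is $$\hat M^{\mathrm{EFE}}_{ij}=\sum_{(k,\ell)\in\Omega}\bigl(BL^+(e_{u_i}-e_{v_j})\bigr)_{(u_k,v_\ell)}\,M_{k\ell}.$$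 **Theorem.** For every $(i,j)\in[n]\times[m]$ such that $u_i$ and $v_j$ are connected by a path in $\mathcal G(\Omega)$, $\hat M^{\mathrm{EFE}}_{ij}$ is the uniformly minimum-variance unbiased estimator of $M^*_{ij}$ in this model: $\mathbb E[\hat M^{\mathrm{EFE}}_{ij}]=M^*_{ij}$ for every additive $M^*$ and every $\sigma>0$; and if $T$ is any measurable function of the data $M$ (and the known $\Omega$) such that $\mathbb E[T(M)]$ exists and equals $M^*_{ij}$ for every additive $M^*$ and every $\sigma>0$, then $\operatorname{Var}[\hat M^{\mathrm{EFE}}_{ij}]\le\operatorname{Var}[T(M)]\in[0,\infty]$ for every additive $M^*$ and every $\sigma>0$. Moreover, for every additive $M^*$ and every $\sigma>0$ this estimator has finite variance $$\operatorname{Var}\bigl[\hat M^{\mathrm{EFE}}_{ij}\bigr]=\sigma^2R(u_i,v_j).$$ -/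

import Mathlib

open MeasureTheory ProbabilityTheory
open scoped Matrix NNReal ENNReal

noncomputable section

/-! ### Moore-Penrose pseudo-inverse of a real matrix -/

/-- `X` is the Moore-Penrose pseudo-inverse of the real matrix `A` (the four Penrose equations). -/
structure Matrix.IsMoorePenrose {p q : Type*} [Fintype p] [Fintype q]
    (A : Matrix p q ℝ) (X : Matrix q p ℝ) : Prop where
  mul_mul_self : A * X * A = A
  self_mul_mul : X * A * X = X
  symm_left : (A * X)ᵀ = A * X
  symm_right : (X * A)ᵀ = X * A

theorem Matrix.IsMoorePenrose.unique {p q : Type*} [Fintype p] [Fintype q]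
    {A : Matrix p q ℝ} {X Y : Matrix q p ℝ}
    (hX : A.IsMoorePenrose X) (hY : A.IsMoorePenrose Y) : X = Y := by
  have h1 : A * X = A * Y := by
    calc A * X = (A * X)ᵀ := hX.symm_left.symm
      _ = ((A * Y) * (A * X))ᵀ := by rw [← Matrix.mul_assoc, hY.mul_mul_self]
      _ = (A * X) * (A * Y) := by rw [Matrix.transpose_mul, hX.symm_left, hY.symm_left]
      _ = A * Y := by rw [← Matrix.mul_assoc, hX.mul_mul_self]
  have h2 : X * A = Y * A := by
    calc X * A = (X * A)ᵀ := hX.symm_right.symm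
      _ = ((X * A) * (Y * A))ᵀ := by
          rw [Matrix.mul_assoc X A, ← Matrix.mul_assoc A Y A, hY.mul_mul_self]
      _ = (Y * A) * (X * A) := by rw [Matrix.transpose_mul, hX.symm_right, hY.symm_right]
      _ = Y * A := by rw [Matrix.mul_assoc Y A, ← Matrix.mul_assoc A X A, hX.mul_mul_self]
  calc X = X * A * X := hX.self_mul_mul.symm
    _ = Y * A * X := by rw [h2]
    _ = Y * (A * X) := Matrix.mul_assoc _ _ _
    _ = Y * (A * Y) := by rw [h1]
    _ = Y * A * Y := (Matrix.mul_assoc _ _ _).symm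
    _ = Y := hY.self_mul_mul

theorem Matrix.exists_isMoorePenrose {p q : Type*} [Fintype p] [Fintype q]
    (A : Matrix p q ℝ) : ∃ X, A.IsMoorePenrose X := by
  classical
  have hH : (Aᵀ * A).IsHermitian := by
    rw [Matrix.IsHermitian, Matrix.conjTranspose_eq_transpose_of_trivial, Matrix.transpose_mul,
      Matrix.transpose_transpose]
  set H := Aᵀ * A with hHdef
  set V : Matrix q q ℝ := (hH.eigenvectorUnitary : Matrix q q ℝ) with hV
  have hVV : Vᵀ * V = 1 := by
    have := Unitary.coe_star_mul_self hH.eigenvectorUnitary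
    rwa [Matrix.star_eq_conjTranspose, Matrix.conjTranspose_eq_transpose_of_trivial] at this
  set D : Matrix q q ℝ := Matrix.diagonal hH.eigenvalues with hD
  set D' : Matrix q q ℝ := Matrix.diagonal (fun k => (hH.eigenvalues k)⁻¹) with hD'
  have hspec : H = V * D * Vᵀ := by
    have := hH.spectral_theorem
    rw [Unitary.conjStarAlgAut_apply] at this
    rw [← Matrix.conjTranspose_eq_transpose_of_trivial V, ← Matrix.star_eq_conjTranspose]
    exact this
  have hDt : Dᵀ = D := Matrix.diagonal_transpose _
  have hDt' : D'ᵀ = D' := Matrix.diagonal_transpose _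
  have hDDD : D * D' * D = D := by
    simp only [hD, hD', Matrix.diagonal_mul_diagonal]
    congr 1; funext k; exact mul_inv_mul_cancel _
  have hDDD' : D' * D * D' = D' := by
    simp only [hD, hD', Matrix.diagonal_mul_diagonal]
    congr 1; funext k
    simpa using mul_inv_mul_cancel (hH.eigenvalues k)⁻¹
  have hcomm : D' * D = D * D' := by
    simp only [hD, hD', Matrix.diagonal_mul_diagonal]
    congr 1; funext k; exact mul_comm _ _
  set G : Matrix q q ℝ := V * D' * Vᵀ with hG
  have key : ∀ P Q : Matrix q q ℝ, (V * P * Vᵀ) * (V * Q * Vᵀ) = V * (P * Q) * Vᵀ := by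
    intro P Q
    calc (V * P * Vᵀ) * (V * Q * Vᵀ) = V * P * (Vᵀ * V) * Q * Vᵀ := by
          simp only [Matrix.mul_assoc]
      _ = V * (P * Q) * Vᵀ := by rw [hVV]; simp only [Matrix.mul_assoc, Matrix.one_mul]
  have hHGH : H * G * H = H := by rw [hspec, hG, key, key, hDDD]
  have hGHG : G * H * G = G := by rw [hspec, hG, key, key, hDDD']
  have hGt : Gᵀ = G := by
    rw [hG, Matrix.transpose_mul, Matrix.transpose_mul, Matrix.transpose_transpose, hDt',
      Matrix.mul_assoc]
  have hHt : Hᵀ = H := by rw [hHdef, Matrix.transpose_mul, Matrix.transpose_transpose]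
  have hGH : G * H = H * G := by rw [hspec, hG, key, key, hcomm]
  have hAGH : A * (G * H) = A := by
    rw [← sub_eq_zero, ← Matrix.conjTranspose_mul_self_eq_zero,
      Matrix.conjTranspose_eq_transpose_of_trivial, Matrix.transpose_sub, Matrix.transpose_mul,
      Matrix.transpose_mul, hGt, hHt, Matrix.sub_mul]
    have e1 : Aᵀ * (A * (G * H) - A) = 0 := by
      rw [Matrix.mul_sub, ← Matrix.mul_assoc, ← hHdef, ← Matrix.mul_assoc, hHGH, sub_self]
    rw [Matrix.mul_assoc, e1, Matrix.mul_zero, sub_self]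
  refine ⟨G * Aᵀ, ?_, ?_, ?_, ?_⟩
  · rw [Matrix.mul_assoc, Matrix.mul_assoc G, ← hHdef, hAGH]
  · rw [Matrix.mul_assoc G, ← hHdef, ← Matrix.mul_assoc, hGHG]
  · rw [Matrix.transpose_mul, Matrix.transpose_mul, Matrix.transpose_transpose, hGt,
      Matrix.mul_assoc]
  · rw [Matrix.mul_assoc, ← hHdef, Matrix.transpose_mul, hGt, hHt, hGH]

/-- The Moore-Penrose pseudo-inverse `A⁺`. -/
def Matrix.pinv {p q : Type*} [Fintype p] [Fintype q] (A : Matrix p q ℝ) : Matrix q p ℝ :=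
  A.exists_isMoorePenrose.choose

theorem Matrix.isMoorePenrose_pinv {p q : Type*} [Fintype p] [Fintype q] (A : Matrix p q ℝ) :
    A.IsMoorePenrose A.pinv :=
  A.exists_isMoorePenrose.choose_spec

/-! ### Unbiased estimators and UMVUEs for a parametrised family of laws -/

/-- `T` is an unbiased estimator of `g θ` in the statistical model `(P θ)`: a measurable function
of the data whose expectation exists and equals `g θ` for every value `θ` of the parameter. -/
structure IsUnbiasedEstimator {Θ 𝓧 : Type*} [MeasurableSpace 𝓧] (P : Θ → Measure 𝓧)
    (g : Θ → ℝ) (T : 𝓧 → ℝ) : Prop where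
  measurable : Measurable T
  integrable : ∀ θ, Integrable T (P θ)
  mean_eq : ∀ θ, ∫ x, T x ∂(P θ) = g θ

/-- `T` is the uniformly minimum-variance unbiased estimator of `g θ` in the model `(P θ)`: it is
unbiased, and its variance is at most that of any other unbiased estimator, for every `θ`.
Variances are taken in `[0, ∞]`, so competitors with infinite variance are treated correctly. -/
structure IsUMVUE {Θ 𝓧 : Type*} [MeasurableSpace 𝓧] (P : Θ → Measure 𝓧)
    (g : Θ → ℝ) (T : 𝓧 → ℝ) : Prop where
  unbiased : IsUnbiasedEstimator P g T
  evariance_le : ∀ U : 𝓧 → ℝ, IsUnbiasedEstimator P g U →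
    ∀ θ, evariance T (P θ) ≤ evariance U (P θ)

namespace MatrixCompletion

variable {n m : ℕ}

/-! ### The observation graph and its electrical network -/

/-- The bipartite graph of the observation set `Ω ⊆ [n] × [m]`: the row vertex `u_k = inl k` and
the column vertex `v_l = inr l` are adjacent iff the entry `(k, l)` is observed. -/
def obsGraph (Ω : Finset (Fin n × Fin m)) : SimpleGraph (Fin n ⊕ Fin m) where
  Adj
    | Sum.inl k, Sum.inr l => (k, l) ∈ Ω
    | Sum.inr l, Sum.inl k => (k, l) ∈ Ω
    | _, _ => False
  symm := ⟨by rintro (k | l) (k' | l') h <;> exact h⟩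
  loopless := ⟨by rintro (k | l) h <;> exact h⟩

instance (Ω : Finset (Fin n × Fin m)) : DecidableRel (obsGraph Ω).Adj
  | Sum.inl k, Sum.inr l => inferInstanceAs (Decidable ((k, l) ∈ Ω))
  | Sum.inr l, Sum.inl k => inferInstanceAs (Decidable ((k, l) ∈ Ω))
  | Sum.inl _, Sum.inl _ => inferInstanceAs (Decidable False)
  | Sum.inr _, Sum.inr _ => inferInstanceAs (Decidable False)

/-- The graph Laplacian `L(Ω)`. -/
def laplacian (Ω : Finset (Fin n × Fin m)) : Matrix (Fin n ⊕ Fin m) (Fin n ⊕ Fin m) ℝ :=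
  (obsGraph Ω).lapMatrix ℝ

/-- The oriented incidence matrix `B(Ω)`, edges being oriented from rows to columns. -/
def incidence (Ω : Finset (Fin n × Fin m)) : Matrix Ω (Fin n ⊕ Fin m) ℝ :=
  Matrix.of fun e w =>
    if w = Sum.inl e.1.1 then 1 else if w = Sum.inr e.1.2 then -1 else 0

/-- The vector `e_s - e_t`. -/
def unitDipole (s t : Fin n ⊕ Fin m) : Fin n ⊕ Fin m → ℝ :=
  Pi.single s 1 - Pi.single t 1

/-- The unit electrical flow from `u_i` to `v_j` with unit resistances,
`B(Ω) L⁺(Ω) (e_{u_i} - e_{v_j})`. -/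
def electricalFlow (Ω : Finset (Fin n × Fin m)) (i : Fin n) (j : Fin m) : Ω → ℝ :=
  incidence Ω *ᵥ ((laplacian Ω).pinv *ᵥ unitDipole (Sum.inl i) (Sum.inr j))

/-- The effective resistance `R(s, t) = (e_s - e_t)ᵀ L⁺(Ω) (e_s - e_t)`. -/
def effectiveResistance (Ω : Finset (Fin n × Fin m)) (s t : Fin n ⊕ Fin m) : ℝ :=
  unitDipole s t ⬝ᵥ ((laplacian Ω).pinv *ᵥ unitDipole s t)

/-- The electrical flow estimator of entry `(i, j)`: the inner product of the electrical flow with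
the vector of observed entries of the data matrix `M`. -/
def electricalFlowEstimator (Ω : Finset (Fin n × Fin m)) (i : Fin n) (j : Fin m)
    (M : Fin n → Fin m → ℝ) : ℝ :=
  ∑ e : Ω, electricalFlow Ω i j e * M e.1.1 e.1.2

/-! ### The additive Gaussian model

Data and signal matrices are functions `Fin n → Fin m → ℝ`, with the Borel sigma-algebra of
`ℝ^(n × m)`. -/

/-- `M` is additive: `M_{kl} = a_k + b_l` for some vectors `a`, `b`. -/
def IsAdditive (M : Fin n → Fin m → ℝ) : Prop :=
  ∃ (a : Fin n → ℝ) (b : Fin m → ℝ), ∀ k l, M k l = a k + b l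

/-- The unknown parameter of the model: an additive signal matrix `M*` and a noise level `σ > 0`. -/
structure Param (n m : ℕ) where
  signal : Fin n → Fin m → ℝ
  additive : IsAdditive signal
  σ : ℝ
  σ_pos : 0 < σ

/-- The masking `Ω ∘ X`: unobserved entries are replaced by `0`. -/
def mask (Ω : Finset (Fin n × Fin m)) (X : Fin n → Fin m → ℝ) : Fin n → Fin m → ℝ :=
  fun k l => if (k, l) ∈ Ω then X k l else 0

/-- The law of a noise matrix `E` with i.i.d. `N(0, σ²)` entries. -/
def noiseLaw (n m : ℕ) (σ : ℝ) : Measure (Fin n → Fin m → ℝ) :=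
  Measure.pi fun _ : Fin n => Measure.pi fun _ : Fin m => gaussianReal 0 (σ ^ 2).toNNReal

/-- The law of the data matrix `M = Ω ∘ (M* + E)`, where `E` has i.i.d. `N(0, σ²)` entries. -/
def dataLaw (Ω : Finset (Fin n × Fin m)) (θ : Param n m) : Measure (Fin n → Fin m → ℝ) :=
  (noiseLaw n m θ.σ).map fun E => mask Ω (θ.signal + E)

end MatrixCompletion

end

namespace MatrixCompletion

variable {n m : ℕ}

/-! ### The electrical network -/

/-! Put φ = L⁺(e_{u_i} - e_{v_j}) and q = Bφ. Connectedness gives Lφ = e_{u_i} - e_{v_j}, so L = BᵀB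
yields q · By = y(u_i) - y(v_j) for every potential y (`electricalFlow_dotProduct_incidence`). An
additive signal is such a difference By on Ω, hence unbiasedness; y = φ gives |q|² = R, hence the
variance σ²R.

Optimality holds because q is itself the observed part of an additive matrix P, the potential
differences of φ. The signals M* + tP with σ fixed remain in the model, and along them the estimand
moves by t P_ij = tR. The likelihood ratio of this shift has second moment exp(t²R/σ²), so
Cauchy–Schwarz bounds the variance of an unbiased U below by (tR)²/(exp(t²R/σ²) - 1), which tends to
σ²R as t → 0 (`mul_le_variance_of_likelihoodRatio`). Finite differences in t replace differentiation
under the integral, and no completeness argument is needed. -/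

theorem incidence_mulVec (Ω : Finset (Fin n × Fin m)) (y : Fin n ⊕ Fin m → ℝ) (e : Ω) :
    (incidence Ω *ᵥ y) e = y (Sum.inl e.1.1) - y (Sum.inr e.1.2) := by
  have h : ∀ w, incidence Ω e w * y w = (Pi.single (Sum.inl e.1.1) 1 : Fin n ⊕ Fin m → ℝ) w * y w
      - (Pi.single (Sum.inr e.1.2) 1 : Fin n ⊕ Fin m → ℝ) w * y w := by
    rintro (k | l) <;> simp [incidence, Pi.single_apply, neg_ite]
  simp only [Matrix.mulVec, dotProduct, h, Finset.sum_sub_distrib]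
  simp [Pi.single_apply]

theorem unitDipole_dotProduct (s t : Fin n ⊕ Fin m) (y : Fin n ⊕ Fin m → ℝ) :
    unitDipole s t ⬝ᵥ y = y s - y t := by
  simp [unitDipole, sub_dotProduct]

theorem laplacian_transpose (Ω : Finset (Fin n × Fin m)) : (laplacian Ω)ᵀ = laplacian Ω :=
  (obsGraph Ω).isSymm_lapMatrix ℝ

theorem dotProduct_laplacian_self (Ω : Finset (Fin n × Fin m)) (y : Fin n ⊕ Fin m → ℝ) :
    y ⬝ᵥ (laplacian Ω *ᵥ y) = (incidence Ω *ᵥ y) ⬝ᵥ (incidence Ω *ᵥ y) := by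
  have h := SimpleGraph.lapMatrix_toLinearMap₂' ℝ (obsGraph Ω) y
  rw [Matrix.toLinearMap₂'_apply'] at h
  rw [laplacian, h]
  have hadj1 : ∀ k l, (obsGraph Ω).Adj (Sum.inl k) (Sum.inr l) ↔ (k, l) ∈ Ω := fun _ _ => Iff.rfl
  have hadj2 : ∀ k l, (obsGraph Ω).Adj (Sum.inr l) (Sum.inl k) ↔ (k, l) ∈ Ω := fun _ _ => Iff.rfl
  have hadj3 : ∀ k l, ¬ (obsGraph Ω).Adj (Sum.inl k) (Sum.inl l) := fun _ _ h => h
  have hadj4 : ∀ k l, ¬ (obsGraph Ω).Adj (Sum.inr k) (Sum.inr l) := fun _ _ h => h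
  have hsum : ∑ e : Ω, (y (Sum.inl e.1.1) - y (Sum.inr e.1.2)) ^ 2
      = ∑ k, ∑ l, if (k, l) ∈ Ω then (y (Sum.inl k) - y (Sum.inr l)) ^ 2 else 0 := by
    rw [Finset.sum_coe_sort Ω (fun e => (y (Sum.inl e.1) - y (Sum.inr e.2)) ^ 2),
      ← Fintype.sum_prod_type' (fun k l => if (k, l) ∈ Ω then
        (y (Sum.inl k) - y (Sum.inr l)) ^ 2 else 0)]
    simp
  simp only [Fintype.sum_sum_type, hadj1, hadj2, hadj3, hadj4, if_false, Finset.sum_const_zero,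
    zero_add, add_zero, dotProduct, incidence_mulVec, ← sq, hsum]
  -- The Laplacian form is half a sum over ordered pairs. Its row-column and column-row blocks
  -- agree, which cancels the factor 1/2.
  rw [Finset.sum_comm (γ := Fin m)]
  simp only [sub_sq_comm (y (Sum.inr _)) (y (Sum.inl _))]
  ring

/-- Polarisation of the quadratic identity, using the symmetry of L. -/
theorem incidence_dotProduct_incidence (Ω : Finset (Fin n × Fin m)) (x y : Fin n ⊕ Fin m → ℝ) :
    (incidence Ω *ᵥ x) ⬝ᵥ (incidence Ω *ᵥ y) = (laplacian Ω *ᵥ x) ⬝ᵥ y := by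
  have h := dotProduct_laplacian_self Ω (x + y)
  have hx := dotProduct_laplacian_self Ω x
  have hy := dotProduct_laplacian_self Ω y
  have hs : x ⬝ᵥ (laplacian Ω *ᵥ y) = (laplacian Ω *ᵥ x) ⬝ᵥ y := by
    rw [Matrix.dotProduct_mulVec, ← Matrix.mulVec_transpose, laplacian_transpose]
  have hc := dotProduct_comm (incidence Ω *ᵥ x) (incidence Ω *ᵥ y)
  have hc' := dotProduct_comm y (laplacian Ω *ᵥ x)
  simp only [Matrix.mulVec_add, add_dotProduct, dotProduct_add] at h
  linarith

/-- The residual z = d - LL⁺d lies in ker L, so it is constant on connected components and hence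
orthogonal to d. It is also orthogonal to the range of the symmetric matrix L, so z · z = 0. -/
theorem laplacian_mulVec_pinv_unitDipole (Ω : Finset (Fin n × Fin m)) {s t : Fin n ⊕ Fin m}
    (h : (obsGraph Ω).Reachable s t) :
    laplacian Ω *ᵥ ((laplacian Ω).pinv *ᵥ unitDipole s t) = unitDipole s t := by
  have hP := (laplacian Ω).isMoorePenrose_pinv
  set L := laplacian Ω with hL
  set d := unitDipole s t
  have hLt : Lᵀ = L := laplacian_transpose Ω
  have hLLP : L * L * L.pinv = L := by
    have := congrArg Matrix.transpose hP.mul_mul_self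
    rwa [Matrix.transpose_mul, hP.symm_left, hLt, ← Matrix.mul_assoc] at this
  set z := d - L *ᵥ (L.pinv *ᵥ d) with hz
  have hLz : L *ᵥ z = 0 := by
    rw [hz, Matrix.mulVec_sub, Matrix.mulVec_mulVec, Matrix.mulVec_mulVec, hLLP, sub_self]
  have hst : z s = z t :=
    (SimpleGraph.lapMatrix_mulVec_eq_zero_iff_forall_reachable (obsGraph Ω)).1 hLz s t h
  have hzz : z ⬝ᵥ z = 0 := by
    nth_rewrite 2 [hz]
    rw [dotProduct_sub, dotProduct_comm z d, unitDipole_dotProduct, hst, sub_self,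
      Matrix.dotProduct_mulVec, ← Matrix.mulVec_transpose, hLt, hLz, zero_dotProduct, sub_self]
  exact (sub_eq_zero.1 (dotProduct_self_eq_zero.1 hzz)).symm

/-- Against the potential differences of `y`, the unit flow computes `y s - y t`. -/
theorem electricalFlow_dotProduct_incidence {Ω : Finset (Fin n × Fin m)} {i : Fin n} {j : Fin m}
    (h : (obsGraph Ω).Reachable (Sum.inl i) (Sum.inr j)) (y : Fin n ⊕ Fin m → ℝ) :
    electricalFlow Ω i j ⬝ᵥ (incidence Ω *ᵥ y) = y (Sum.inl i) - y (Sum.inr j) := by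
  rw [electricalFlow, incidence_dotProduct_incidence, laplacian_mulVec_pinv_unitDipole Ω h,
    unitDipole_dotProduct]

/-- The matrix of potential differences of the unit electrical flow. -/
noncomputable def potentialMatrix (Ω : Finset (Fin n × Fin m)) (i : Fin n) (j : Fin m) :
    Fin n → Fin m → ℝ := fun k l =>
  ((laplacian Ω).pinv *ᵥ unitDipole (Sum.inl i) (Sum.inr j)) (Sum.inl k)
    - ((laplacian Ω).pinv *ᵥ unitDipole (Sum.inl i) (Sum.inr j)) (Sum.inr l)

theorem isAdditive_potentialMatrix (Ω : Finset (Fin n × Fin m)) (i : Fin n) (j : Fin m) :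
    IsAdditive (potentialMatrix Ω i j) :=
  ⟨_, _, fun _ _ => sub_eq_add_neg _ _⟩

theorem potentialMatrix_self (Ω : Finset (Fin n × Fin m)) (i : Fin n) (j : Fin m) :
    potentialMatrix Ω i j i j = effectiveResistance Ω (Sum.inl i) (Sum.inr j) := by
  rw [potentialMatrix, effectiveResistance, ← unitDipole_dotProduct]

theorem electricalFlow_eq_potentialMatrix (Ω : Finset (Fin n × Fin m)) (i : Fin n) (j : Fin m)
    (e : Ω) : electricalFlow Ω i j e = potentialMatrix Ω i j e.1.1 e.1.2 :=
  incidence_mulVec _ _ _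

theorem electricalFlowEstimator_of_isAdditive {Ω : Finset (Fin n × Fin m)} {i : Fin n} {j : Fin m}
    (h : (obsGraph Ω).Reachable (Sum.inl i) (Sum.inr j)) {M : Fin n → Fin m → ℝ}
    (hM : IsAdditive M) : electricalFlowEstimator Ω i j M = M i j := by
  obtain ⟨a, b, hab⟩ := hM
  -- The sign on b turns the difference taken by the incidence matrix into the sum a_k + b_l.
  have := electricalFlow_dotProduct_incidence h (Sum.elim a (-b))
  simpa [dotProduct, incidence_mulVec, electricalFlowEstimator, hab] using this

/-- The estimator as a full sum against the masked potential differences. -/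
theorem electricalFlowEstimator_eq_sum (Ω : Finset (Fin n × Fin m)) (i : Fin n) (j : Fin m)
    (M : Fin n → Fin m → ℝ) :
    electricalFlowEstimator Ω i j M
      = ∑ k, ∑ l, mask Ω (potentialMatrix Ω i j) k l * M k l := by
  simp only [electricalFlowEstimator, electricalFlow_eq_potentialMatrix]
  rw [Finset.sum_coe_sort Ω (fun e => potentialMatrix Ω i j e.1 e.2 * M e.1 e.2),
    ← Fintype.sum_prod_type' (fun k l => mask Ω (potentialMatrix Ω i j) k l * M k l)]
  simp [mask]

/-- The dissipated energy: the estimator applied to the potential matrix is the sum of squares of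
the flow, while exactness on additive matrices evaluates it as the (i, j) entry. -/
theorem sum_sq_mask_potentialMatrix {Ω : Finset (Fin n × Fin m)} {i : Fin n} {j : Fin m}
    (h : (obsGraph Ω).Reachable (Sum.inl i) (Sum.inr j)) :
    ∑ k, ∑ l, mask Ω (potentialMatrix Ω i j) k l ^ 2
      = effectiveResistance Ω (Sum.inl i) (Sum.inr j) := by
  rw [← potentialMatrix_self, ← electricalFlowEstimator_of_isAdditive h
    (isAdditive_potentialMatrix Ω i j), electricalFlowEstimator_eq_sum]
  refine Finset.sum_congr rfl fun k _ => Finset.sum_congr rfl fun l _ => ?_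
  by_cases hkl : (k, l) ∈ Ω <;> simp [mask, hkl, sq]

theorem electricalFlowEstimator_mask (Ω : Finset (Fin n × Fin m)) (i : Fin n) (j : Fin m)
    (M : Fin n → Fin m → ℝ) :
    electricalFlowEstimator Ω i j (mask Ω M) = electricalFlowEstimator Ω i j M := by
  simp [electricalFlowEstimator, mask]

end MatrixCompletion

/-! ### Products of measures with densities -/

/-- It suffices to compare both sides on boxes, where indicator times density is a product of
functions of independent coordinates. -/
theorem MeasureTheory.Measure.pi_withDensity {ι : Type*} [Fintype ι] {α : ι → Type*}
    [∀ i, MeasurableSpace (α i)] {μ ν : ∀ i, Measure (α i)} [∀ i, IsProbabilityMeasure (μ i)]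
    [∀ i, SigmaFinite (ν i)] {g : ∀ i, α i → ℝ≥0∞} (hg : ∀ i, Measurable (g i))
    (h : ∀ i, ν i = (μ i).withDensity (g i)) :
    Measure.pi ν = (Measure.pi μ).withDensity fun x => ∏ i, g i (x i) := by
  refine Measure.pi_eq fun s hs => ?_
  have hind : ∀ i, Measurable ((s i).indicator (g i)) := fun i => (hg i).indicator (hs i)
  have hprod : (Set.univ.pi s).indicator (fun x => ∏ i, g i (x i))
      = fun x => ∏ i, (s i).indicator (g i) (x i) := by
    classical
    ext x
    by_cases hx : x ∈ Set.univ.pi s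
    · rw [Set.indicator_of_mem hx]
      exact Finset.prod_congr rfl fun i _ => (Set.indicator_of_mem (hx i trivial) _).symm
    · rw [Set.indicator_of_notMem hx]
      simp only [Set.mem_univ_pi, not_forall] at hx
      obtain ⟨i, hi⟩ := hx
      exact (Finset.prod_eq_zero (Finset.mem_univ i) (Set.indicator_of_notMem hi _)).symm
  rw [withDensity_apply _ (.univ_pi hs), ← lintegral_indicator (.univ_pi hs), hprod,
    lintegral_prod_eq_prod_lintegral_of_indepFun _ _ (iIndepFun_pi fun i => (hind i).aemeasurable)
      fun i => (hind i).comp (measurable_pi_apply i)]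
  refine Finset.prod_congr rfl fun i _ => ?_
  rw [h, withDensity_apply _ (hs i), ← lintegral_indicator (hs i)]
  exact (measurePreserving_eval μ i).lintegral_comp (hind i)

theorem ProbabilityTheory.gaussianReal_eq_withDensity_gaussianReal_zero (a : ℝ) {v : ℝ≥0}
    (hv : v ≠ 0) : gaussianReal a v = (gaussianReal 0 v).withDensity
      fun x => ENNReal.ofReal (Real.exp (a * x / v - a ^ 2 / (2 * v))) := by
  have hv' : (v : ℝ) ≠ 0 := by exact_mod_cast hv
  rw [gaussianReal_of_var_ne_zero _ hv, gaussianReal_of_var_ne_zero _ hv,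
    ← withDensity_mul _ (measurable_gaussianPDF _ _) (by fun_prop)]
  congr 1
  ext x
  rw [Pi.mul_apply, gaussianPDF, gaussianPDF, ← ENNReal.ofReal_mul (gaussianPDFReal_nonneg _ _ _),
    gaussianPDFReal, gaussianPDFReal,
    mul_assoc _ (Real.exp _), ← Real.exp_add]
  congr 3
  field_simp
  ring

/-- Stated for arbitrary factor spaces so that it applies twice to the nested product `noiseLaw`: to
the entries of a row, then to the row sums. -/
theorem ProbabilityTheory.memLp_and_moments_sum_pi {ι : Type*} [Fintype ι] {α : ι → Type*}
    [∀ i, MeasurableSpace (α i)] {μ : ∀ i, Measure (α i)} [∀ i, IsProbabilityMeasure (μ i)]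
    {X : ∀ i, α i → ℝ} (hX : ∀ i, MemLp (X i) 2 (μ i)) (h0 : ∀ i, ∫ x, X i x ∂(μ i) = 0) :
    MemLp (fun x : ∀ i, α i => ∑ i, X i (x i)) 2 (Measure.pi μ) ∧
    ∫ x, ∑ i, X i (x i) ∂(Measure.pi μ) = 0 ∧
    variance (fun x : ∀ i, α i => ∑ i, X i (x i)) (Measure.pi μ)
      = ∑ i, variance (X i) (μ i) := by
  have hm : ∀ i, MemLp (fun x : ∀ i, α i => X i (x i)) 2 (Measure.pi μ) :=
    fun i => (hX i).comp_measurePreserving (measurePreserving_eval μ i)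
  refine ⟨memLp_finsetSum _ fun i _ => hm i, ?_, ?_⟩
  · rw [integral_finsetSum _ fun i _ => (hm i).integrable (by norm_num)]
    refine Finset.sum_eq_zero fun i _ => ?_
    rw [integral_comp_eval (hX i).aestronglyMeasurable, h0]
  · rw [← variance_sum_pi hX]
    congr 1
    ext x
    simp

/-! ### A Hammersley-Chapman-Robbins bound -/

/-- If, along a one-parameter family of likelihood ratios `ρ t` with second moments
`exp (t ^ 2 * R / s)`, the mean of `U` moves at speed `R`, then `U` has variance at least
`s * R`. -/
theorem ProbabilityTheory.mul_le_variance_of_likelihoodRatio {X : Type*} [MeasurableSpace X]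
    {P : Measure X} [IsProbabilityMeasure P] {U : X → ℝ} (hU : MemLp U 2 P) {R s : ℝ} (hs : 0 < s)
    {ρ : ℝ → X → ℝ} (hρ : ∀ t, MemLp (ρ t) 2 P) (hρ1 : ∀ t, ∫ x, ρ t x ∂P = 1)
    (hρ2 : ∀ t, ∫ x, ρ t x ^ 2 ∂P = Real.exp (t ^ 2 * R / s))
    (hUρ : ∀ t, ∫ x, U x * ρ t x ∂P = ∫ x, U x ∂P + t * R) :
    s * R ≤ variance U P := by
  have key : ∀ t : ℝ, t ≠ 0 → s * R * Real.exp (-(t ^ 2 * R / s)) ≤ variance U P := by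
    intro t ht
    set x := t ^ 2 * R / s with hx
    -- This c minimises c² x eˣ - 2c tR, the upper bound for Var(U - cρ) - Var U. Written this way
    -- it does not divide by R, which may vanish.
    set c := s * Real.exp (-x) / t with hc
    have hvar : variance (ρ t) P ≤ x * Real.exp x := by
      rw [variance_eq_sub (hρ t), hρ1]
      simp only [Pi.pow_apply, hρ2, ← hx]
      have h1 : (-x + 1) * Real.exp x ≤ 1 := by
        calc (-x + 1) * Real.exp x ≤ Real.exp (-x) * Real.exp x :=
              mul_le_mul_of_nonneg_right (Real.add_one_le_exp _) (Real.exp_pos _).le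
          _ = 1 := by rw [← Real.exp_add, neg_add_cancel, Real.exp_zero]
      linarith
    have hcov : covariance U (ρ t) P = t * R := by
      rw [covariance_eq_sub hU (hρ t), hρ1]
      simp only [Pi.mul_apply, hUρ]
      ring
    have hnn : 0 ≤ variance (U - c • ρ t) P := variance_nonneg _ _
    rw [variance_sub hU ((hρ t).const_smul c), variance_smul, covariance_smul_right, hcov] at hnn
    have h2 : c ^ 2 * variance (ρ t) P ≤ c ^ 2 * (x * Real.exp x) :=
      mul_le_mul_of_nonneg_left hvar (sq_nonneg _)
    have hee : Real.exp (-x) * Real.exp x = 1 := by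
      rw [← Real.exp_add, neg_add_cancel, Real.exp_zero]
    have h3 : c ^ 2 * (x * Real.exp x) = s * R * Real.exp (-x) := by
      calc c ^ 2 * (x * Real.exp x)
          = (Real.exp (-x) * Real.exp x) * (s ^ 2 * x / t ^ 2) * Real.exp (-x) := by
            rw [hc]; ring
        _ = s * R * Real.exp (-x) := by rw [hee, hx]; field_simp
    have h4 : c * (t * R) = s * R * Real.exp (-x) := by rw [hc]; field_simp
    linarith
  have hlim : Filter.Tendsto (fun t : ℝ => s * R * Real.exp (-(t ^ 2 * R / s)))
      (nhdsWithin 0 {0}ᶜ) (nhds (s * R)) := by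
    have : ContinuousAt (fun t : ℝ => s * R * Real.exp (-(t ^ 2 * R / s))) 0 := by fun_prop
    have h0 := this.tendsto
    simp only [ne_eq, OfNat.ofNat_ne_zero, not_false_eq_true, zero_pow, zero_mul, zero_div,
      neg_zero, Real.exp_zero, mul_one] at h0
    exact h0.mono_left nhdsWithin_le_nhds
  exact le_of_tendsto hlim (eventually_nhdsWithin_of_forall key)

namespace MatrixCompletion

variable {n m : ℕ}

/-! ### The Gaussian noise -/

instance (σ : ℝ) : IsProbabilityMeasure (noiseLaw n m σ) := by
  unfold noiseLaw; infer_instance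

theorem sum_noiseLaw (V : Fin n → Fin m → ℝ) (σ : ℝ) :
    MemLp (fun E : Fin n → Fin m → ℝ => ∑ k, ∑ l, V k l * E k l) 2 (noiseLaw n m σ) ∧
    ∫ E, ∑ k, ∑ l, V k l * E k l ∂(noiseLaw n m σ) = 0 ∧
    variance (fun E : Fin n → Fin m → ℝ => ∑ k, ∑ l, V k l * E k l) (noiseLaw n m σ)
      = σ ^ 2 * ∑ k, ∑ l, V k l ^ 2 := by
  have hentry : ∀ k l, MemLp (fun x : ℝ => V k l * x) 2 (gaussianReal 0 (σ ^ 2).toNNReal) :=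
    fun k l => (memLp_id_gaussianReal' 2 (by simp)).const_mul _
  have hrow := fun k => memLp_and_moments_sum_pi (hentry k)
    (fun l => by rw [integral_const_mul, integral_id_gaussianReal, mul_zero])
  have hall := memLp_and_moments_sum_pi (fun k => (hrow k).1) (fun k => (hrow k).2.1)
  refine ⟨hall.1, hall.2.1, hall.2.2.trans ?_⟩
  rw [Finset.mul_sum]
  refine Finset.sum_congr rfl fun k _ => (hrow k).2.2.trans ?_
  rw [Finset.mul_sum]
  refine Finset.sum_congr rfl fun l _ => ?_
  rw [variance_const_mul, variance_fun_id_gaussianReal, Real.coe_toNNReal _ (sq_nonneg _), mul_comm]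

/-- The density of the noise matrix shifted by `V` with respect to the noise matrix. -/
noncomputable def shiftDensity (V : Fin n → Fin m → ℝ) (σ : ℝ) (E : Fin n → Fin m → ℝ) : ℝ :=
  Real.exp ((∑ k, ∑ l, V k l * E k l) / σ ^ 2 - (∑ k, ∑ l, V k l ^ 2) / (2 * σ ^ 2))

theorem measurable_shiftDensity (V : Fin n → Fin m → ℝ) (σ : ℝ) :
    Measurable (shiftDensity V σ) := by
  unfold shiftDensity; fun_prop

theorem noiseLaw_map_add_eq_pi (V : Fin n → Fin m → ℝ) (σ : ℝ) :
    (noiseLaw n m σ).map (V + ·)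
      = Measure.pi fun k => Measure.pi fun l => gaussianReal (V k l) (σ ^ 2).toNNReal := by
  set γ := gaussianReal 0 (σ ^ 2).toNNReal with hγ
  have hrow : ∀ k, (Measure.pi fun _ : Fin m => γ).map (fun x l => V k l + x l)
      = Measure.pi fun l => gaussianReal (V k l) (σ ^ 2).toNNReal := fun k => by
    rw [Measure.pi_map_pi (f := fun l x => V k l + x) (fun l => by fun_prop)]
    simp [hγ, gaussianReal_map_const_add]
  have : ∀ k, SigmaFinite ((Measure.pi fun _ : Fin m => γ).map (fun x l => V k l + x l)) :=
    fun k => by rw [hrow]; infer_instance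
  simp_rw [← hrow]
  exact Measure.pi_map_pi (μ := fun _ : Fin n => Measure.pi fun _ : Fin m => γ)
    (f := fun k (x : Fin m → ℝ) l => V k l + x l)
    fun k => (measurable_pi_lambda _ fun l => by fun_prop).aemeasurable

theorem noiseLaw_map_add (V : Fin n → Fin m → ℝ) {σ : ℝ} (hσ : 0 < σ) :
    (noiseLaw n m σ).map (V + ·)
      = (noiseLaw n m σ).withDensity fun E => ENNReal.ofReal (shiftDensity V σ E) := by
  set v : ℝ≥0 := (σ ^ 2).toNNReal with hv
  have hvσ : (v : ℝ) = σ ^ 2 := Real.coe_toNNReal _ (sq_nonneg _)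
  have hv0 : v ≠ 0 := by simpa [hv] using hσ.ne'
  have hrow : ∀ k, Measure.pi (fun l : Fin m => gaussianReal (V k l) v)
      = (Measure.pi fun _ : Fin m => gaussianReal 0 v).withDensity fun x =>
        ∏ l, ENNReal.ofReal (Real.exp (V k l * x l / v - V k l ^ 2 / (2 * v))) := fun k =>
    Measure.pi_withDensity
      (g := fun l x => ENNReal.ofReal (Real.exp (V k l * x / v - V k l ^ 2 / (2 * v))))
      (fun l => by fun_prop) fun l => gaussianReal_eq_withDensity_gaussianReal_zero _ hv0
  rw [noiseLaw_map_add_eq_pi, Measure.pi_withDensity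
    (g := fun k (x : Fin m → ℝ) =>
      ∏ l, ENNReal.ofReal (Real.exp (V k l * x l / v - V k l ^ 2 / (2 * v))))
    (fun k => by fun_prop) hrow, noiseLaw]
  congr 1
  ext E
  simp_rw [← ENNReal.ofReal_prod_of_nonneg (fun _ _ => (Real.exp_pos _).le), ← Real.exp_sum]
  rw [← ENNReal.ofReal_prod_of_nonneg (fun _ _ => (Real.exp_pos _).le), ← Real.exp_sum,
    shiftDensity, hvσ]
  simp only [Finset.sum_sub_distrib, Finset.sum_div]

theorem integral_comp_add_noiseLaw (V : Fin n → Fin m → ℝ) {σ : ℝ} (hσ : 0 < σ)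
    {f : (Fin n → Fin m → ℝ) → ℝ} (hf : Measurable f) :
    ∫ E, f (V + E) ∂(noiseLaw n m σ) = ∫ E, f E * shiftDensity V σ E ∂(noiseLaw n m σ) := by
  rw [← integral_map (φ := (V + ·)) (by fun_prop) hf.aestronglyMeasurable,
    noiseLaw_map_add V hσ, integral_withDensity_eq_integral_toReal_smul
      (measurable_shiftDensity V σ).ennreal_ofReal (by simp)]
  refine integral_congr_ae (.of_forall fun E => ?_)
  simp only [ENNReal.toReal_ofReal (Real.exp_pos _).le, shiftDensity, smul_eq_mul, mul_comm]

theorem integral_shiftDensity (V : Fin n → Fin m → ℝ) {σ : ℝ} (hσ : 0 < σ) :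
    ∫ E, shiftDensity V σ E ∂(noiseLaw n m σ) = 1 := by
  simpa using (integral_comp_add_noiseLaw V hσ (measurable_const (a := (1 : ℝ)))).symm

/-- Squaring is, up to a constant, shifting by 2V; second moments thus reduce to the total mass of
another shifted law. -/
theorem shiftDensity_sq (V : Fin n → Fin m → ℝ) (σ : ℝ) (E : Fin n → Fin m → ℝ) :
    shiftDensity V σ E ^ 2
      = Real.exp ((∑ k, ∑ l, V k l ^ 2) / σ ^ 2) * shiftDensity ((2 : ℝ) • V) σ E := by
  simp only [shiftDensity, Pi.smul_apply, smul_eq_mul, mul_pow, mul_assoc, ← Finset.mul_sum]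
  rw [← Real.exp_nat_mul, ← Real.exp_add]
  congr 1
  push_cast
  ring

theorem integral_shiftDensity_sq (V : Fin n → Fin m → ℝ) {σ : ℝ} (hσ : 0 < σ) :
    ∫ E, shiftDensity V σ E ^ 2 ∂(noiseLaw n m σ)
      = Real.exp ((∑ k, ∑ l, V k l ^ 2) / σ ^ 2) := by
  simp_rw [shiftDensity_sq, integral_const_mul, integral_shiftDensity _ hσ, mul_one]

theorem memLp_shiftDensity (V : Fin n → Fin m → ℝ) {σ : ℝ} (hσ : 0 < σ) :
    MemLp (shiftDensity V σ) 2 (noiseLaw n m σ) := by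
  rw [memLp_two_iff_integrable_sq (measurable_shiftDensity V σ).aestronglyMeasurable]
  -- The integral of a non-integrable function is 0 by convention, so a nonzero value proves
  -- integrability.
  refine .of_integral_ne_zero ?_
  rw [integral_shiftDensity_sq V hσ]
  exact (Real.exp_pos _).ne'

/-! ### The law of the data -/

theorem measurable_mask (Ω : Finset (Fin n × Fin m)) : Measurable (mask Ω) := by
  refine measurable_pi_lambda _ fun k => measurable_pi_lambda _ fun l => ?_
  by_cases h : (k, l) ∈ Ω
  · simp only [mask, h, if_true]; fun_prop
  · simp only [mask, h, if_false]; fun_prop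

theorem measurable_mask_add (Ω : Finset (Fin n × Fin m)) (S : Fin n → Fin m → ℝ) :
    Measurable fun E => mask Ω (S + E) :=
  (measurable_mask Ω).comp (measurable_const_add S)

instance (Ω : Finset (Fin n × Fin m)) (θ : Param n m) : IsProbabilityMeasure (dataLaw Ω θ) :=
  Measure.isProbabilityMeasure_map (measurable_mask_add Ω θ.signal).aemeasurable

theorem measurable_electricalFlowEstimator (Ω : Finset (Fin n × Fin m)) (i : Fin n) (j : Fin m) :
    Measurable (electricalFlowEstimator Ω i j) := by
  unfold electricalFlowEstimator; fun_prop

theorem electricalFlowEstimator_mask_add {Ω : Finset (Fin n × Fin m)} {i : Fin n} {j : Fin m}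
    (h : (obsGraph Ω).Reachable (Sum.inl i) (Sum.inr j)) {S : Fin n → Fin m → ℝ}
    (hS : IsAdditive S) (E : Fin n → Fin m → ℝ) :
    electricalFlowEstimator Ω i j (mask Ω (S + E))
      = ∑ k, ∑ l, mask Ω (potentialMatrix Ω i j) k l * E k l + S i j := by
  rw [electricalFlowEstimator_mask, ← electricalFlowEstimator_of_isAdditive h hS,
    electricalFlowEstimator_eq_sum, electricalFlowEstimator_eq_sum]
  simp only [Pi.add_apply, mul_add, Finset.sum_add_distrib, add_comm]

/-- The electrical flow estimator is square integrable, unbiased, and its variance is the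
effective resistance times the noise level. -/
theorem moments_electricalFlowEstimator {Ω : Finset (Fin n × Fin m)} {i : Fin n} {j : Fin m}
    (h : (obsGraph Ω).Reachable (Sum.inl i) (Sum.inr j)) (θ : Param n m) :
    MemLp (electricalFlowEstimator Ω i j) 2 (dataLaw Ω θ) ∧
    ∫ M, electricalFlowEstimator Ω i j M ∂(dataLaw Ω θ) = θ.signal i j ∧
    variance (electricalFlowEstimator Ω i j) (dataLaw Ω θ)
      = θ.σ ^ 2 * effectiveResistance Ω (Sum.inl i) (Sum.inr j) := by
  have hφ := (measurable_mask_add Ω θ.signal).aemeasurable (μ := noiseLaw n m θ.σ)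
  have hT := measurable_electricalFlowEstimator Ω i j
  have hcomp : electricalFlowEstimator Ω i j ∘ (fun E => mask Ω (θ.signal + E))
      = fun E => ∑ k, ∑ l, mask Ω (potentialMatrix Ω i j) k l * E k l + θ.signal i j :=
    funext fun E => electricalFlowEstimator_mask_add h θ.additive E
  obtain ⟨hL, hmean, hvar⟩ := sum_noiseLaw (mask Ω (potentialMatrix Ω i j)) θ.σ
  refine ⟨?_, ?_, ?_⟩
  · rw [dataLaw, memLp_map_measure_iff hT.aestronglyMeasurable hφ, hcomp]
    exact hL.add (memLp_const _)
  · rw [dataLaw, integral_map hφ hT.aestronglyMeasurable]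
    simp only [electricalFlowEstimator_mask_add h θ.additive]
    rw [integral_add (hL.integrable (by norm_num)) (integrable_const _), hmean]
    simp
  · rw [dataLaw, variance_map hT.aemeasurable hφ, hcomp,
      variance_add_const hL.aestronglyMeasurable, hvar, sum_sq_mask_potentialMatrix h]

/-- The parameter shifted by `t` times the potential differences of the unit flow. -/
noncomputable def Param.shift (θ : Param n m) (Ω : Finset (Fin n × Fin m)) (i : Fin n) (j : Fin m)
    (t : ℝ) : Param n m where
  signal := θ.signal + t • potentialMatrix Ω i j
  additive := by
    obtain ⟨a, b, hab⟩ := θ.additive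
    obtain ⟨a', b', hab'⟩ := isAdditive_potentialMatrix Ω i j
    refine ⟨a + t • a', b + t • b', fun k l => ?_⟩
    simp only [Pi.add_apply, Pi.smul_apply, smul_eq_mul, hab, hab']
    ring
  σ := θ.σ
  σ_pos := θ.σ_pos

/-- Only the observed part of the shift affects the data, so the noise can be translated by the
masked potentials alone. Their squared norm is R; unobserved entries would enlarge it and weaken the
bound. -/
theorem integral_dataLaw_shift (θ : Param n m) (Ω : Finset (Fin n × Fin m)) (i : Fin n)
    (j : Fin m) (t : ℝ) {U : (Fin n → Fin m → ℝ) → ℝ} (hU : Measurable U) :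
    ∫ M, U M ∂(dataLaw Ω (θ.shift Ω i j t)) = ∫ E, U (mask Ω (θ.signal + E))
      * shiftDensity (t • mask Ω (potentialMatrix Ω i j)) θ.σ E ∂(noiseLaw n m θ.σ) := by
  have hmask : ∀ E, mask Ω ((θ.shift Ω i j t).signal + E)
      = mask Ω (θ.signal + (t • mask Ω (potentialMatrix Ω i j) + E)) := fun E => by
    ext k l
    by_cases h : (k, l) ∈ Ω <;> simp [mask, h, Param.shift, add_assoc]
  rw [dataLaw, integral_map (measurable_mask_add Ω _).aemeasurable hU.aestronglyMeasurable]
  simp only [hmask]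
  exact integral_comp_add_noiseLaw _ θ.σ_pos (hU.comp (measurable_mask_add Ω θ.signal))

theorem le_variance_of_isUnbiasedEstimator {Ω : Finset (Fin n × Fin m)} {i : Fin n} {j : Fin m}
    (h : (obsGraph Ω).Reachable (Sum.inl i) (Sum.inr j)) {U : (Fin n → Fin m → ℝ) → ℝ}
    (hU : IsUnbiasedEstimator (dataLaw Ω) (fun θ : Param n m => θ.signal i j) U) (θ : Param n m)
    (hL : MemLp U 2 (dataLaw Ω θ)) :
    θ.σ ^ 2 * effectiveResistance Ω (Sum.inl i) (Sum.inr j) ≤ variance U (dataLaw Ω θ) := by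
  have hφ := (measurable_mask_add Ω θ.signal).aemeasurable (μ := noiseLaw n m θ.σ)
  have hUm := hU.measurable
  rw [dataLaw, variance_map hUm.aemeasurable hφ]
  rw [dataLaw, memLp_map_measure_iff hUm.aestronglyMeasurable hφ] at hL
  refine mul_le_variance_of_likelihoodRatio hL (pow_pos θ.σ_pos 2)
    (ρ := fun t => shiftDensity (t • mask Ω (potentialMatrix Ω i j)) θ.σ)
    (fun t => memLp_shiftDensity _ θ.σ_pos) (fun t => integral_shiftDensity _ θ.σ_pos)
    (fun t => ?_) (fun t => ?_)
  · rw [integral_shiftDensity_sq _ θ.σ_pos, ← sum_sq_mask_potentialMatrix h]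
    simp only [Pi.smul_apply, smul_eq_mul, mul_pow, Finset.mul_sum]
  · have h0 := hU.mean_eq θ
    rw [dataLaw, integral_map hφ hUm.aestronglyMeasurable] at h0
    simp only [Function.comp_apply]
    rw [← integral_dataLaw_shift θ Ω i j t hUm, hU.mean_eq, h0, ← potentialMatrix_self]
    rfl

end MatrixCompletion

theorem mainTheorem4 {n m : ℕ} (Ω : Finset (Fin n × Fin m)) (i : Fin n) (j : Fin m)
    (hconn : (MatrixCompletion.obsGraph Ω).Reachable (Sum.inl i) (Sum.inr j)) :
    IsUMVUE (MatrixCompletion.dataLaw Ω) (fun θ : MatrixCompletion.Param n m => θ.signal i j)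
        (MatrixCompletion.electricalFlowEstimator Ω i j) ∧
      ∀ θ : MatrixCompletion.Param n m,
        MemLp (MatrixCompletion.electricalFlowEstimator Ω i j) 2 (MatrixCompletion.dataLaw Ω θ) ∧
        variance (MatrixCompletion.electricalFlowEstimator Ω i j) (MatrixCompletion.dataLaw Ω θ) =
          θ.σ ^ 2 * MatrixCompletion.effectiveResistance Ω (Sum.inl i) (Sum.inr j) := by
  have hT := MatrixCompletion.moments_electricalFlowEstimator hconn
  refine ⟨⟨⟨MatrixCompletion.measurable_electricalFlowEstimator Ω i j,
    fun θ => (hT θ).1.integrable (by norm_num), fun θ => (hT θ).2.1⟩, fun U hU θ => ?_⟩,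
    fun θ => ⟨(hT θ).1, (hT θ).2.2⟩⟩
  -- A competitor that is not square integrable at θ has infinite variance there.
  by_cases hL : MemLp U 2 (MatrixCompletion.dataLaw Ω θ)
  · rw [← ofReal_variance (hT θ).1, ← ofReal_variance hL, (hT θ).2.2]
    exact ENNReal.ofReal_le_ofReal
      (MatrixCompletion.le_variance_of_isUnbiasedEstimator hconn hU θ hL)
  · rw [evariance_eq_top hU.measurable.aestronglyMeasurable hL]
    exact le_top
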